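/- Let $A$ be an associative ring with $1$ and with an involution $a\mapsto\bar a$ ($\overline{a+b}=\bar a+\bar b$, $\overline{ab}=\bar b\,\bar a$, $\bar{\bar a}=a$), and let modules be left $A$-modules. For a module $M$ let $M^t$ be the right module $xa=\bar a x$ and let $M^*=\mathrm{Hom}_A(M,A)$ with $(af)(x)=f(x)\bar a$. A chain complex $C$ is $n$-dimensional if it is chain homotopy equivalent to a complex of f.g. projective modules concentrated in degrees $0,\dots,n$. Conventions. * $C^t\otimes_AC$ has $d(x\otimes y)=x\otimes dy+(-1)^{|y|}dx\otimes y$ and $T(x\otimes y)=(-1)^{|x||y|}y\otimes x$. * $(\widehat W^{\%}C)_m$ is the group of families $\theta=\{\theta_s\in (C^t\otimes_AC)_{m+s}\mid s\in\mathbb Z\}$ with $$(d\theta)_s=d\theta_s+(-1)^{m+s-1}(\theta_{s-1}+(-1)^sT\theta_{s-1}).$$ $(W^{\%}C)_m$ is the group of families $\{\phi_s\mid s\ge 0\}$ with the same differential, where $\phi_{-1}=0$, and $J:W^{\%}C\to\widehat W^{\%}C$ is extension by $0$. Put $Q^m(C)=H_m(W^{\%}C)$ and $\widehat Q^m(C)=H_m(\widehat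 W^{\%}C)$. An $m$-dimensional symmetric (resp. hyperquadratic) structure is an $m$-cycle of $W^{\%}C$ (resp. $\widehat W^{\%}C$). An equivalence $\nu:\theta\to\theta'$ of $m$-dimensional hyperquadratic structures is $\nu\in(\widehat W^{\%}C)_{m+1}$ with $\theta'-\theta=d\nu$. * A chain map $f:C\to D$ induces $\widehat f^{\%}:\widehat W^{\%}C\to\widehat W^{\%}D$ by applying $f\otimes f$ to every $\theta_s$. * $C^{n-*}$ is the complex with $(C^{n-*})_r=(C_{n-r})^*$ and $d=(-1)^r(d_C)^*$ on degree $r$. The suspension $S^nC$ has $(S^nC)_r=C_{r-n}$ with the same differential. * $S^n:(\widehat W^{\%}C)_m\to(\widehat W^{\%}S^nC)_{m+n}$ is $(S^n\theta)_s=\theta_{s-n}$, where $C_p^t\otimes_AC_q$ is identified with $(S^nC)_{p+n}^t\otimes_A(S^nC)_{q+n}$ by the sign $(-1)^{n(p+n)}$, which makes $S^n$ a chain map. Composed with the isomorphism $S^n(C^{0-*})\cong C^{n-*}$, $x\mapsto(-1)^{nr}x$ in degree $r$, it gives $S^n:(\widehat W^{\%}C^{0-*})_m\to(\widehat W^{\%}C^{n-*})_{m+n}$.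 An $n$-dimensional symmetric Poincaré complex $(C,\phi)$ is an $n$-dimensional chain complex $C$ with an $n$-dimensional symmetric structure $\phi\in(W^{\%}C)_n$ for which the chain map $\phi_0:C^{n-*}\to C$, given by the slant $x\otimes y\mapsto(f\mapsto\overline{f(x)}\,y)$, is a chain equivalence. A normal structure $(\gamma,\theta)$ on $(C,\phi)$ is a bundle, i.e. a cycle $\gamma\in(\widehat W^{\%}C^{0-*})_0$, together with an equivalence of $n$-dimensional hyperquadratic structures $\theta:J(\phi)\to(\widehat\phi_0)^{\%}(S^n\gamma)$. An equivalence $(\chi,\eta):(\gamma,\theta)\to(\gamma',\theta')$ of normal structures is an equivalence $\chi:\gamma\to\gamma'$ of hyperquadratic structures on $C^{0-*}$ together with an equivalence $\eta:\theta-\theta'+(\widehat\phi_0)^{\%}(S^n\chi)\to 0$ in $\widehat W^{\%}C$, i.e. $\eta\in(\widehat W^{\%}C)_{n+2}$ with $-(\theta-\theta'+(\widehat\phi_0)^{\%}(S^n\chi))=d\eta$. **Theorem.** Let $n\ge0$ and let $(C,\phi)$ be an $n$-dimensional symmetric Poincaré complex over $A$. Then $(C,\phi)$ has a normal structure, and any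 two normal structures on $(C,\phi)$ are equivalent. Moreover the homomorphisms $(\widehat\phi_0)^{\%}:\widehat Q^n(C^{n-*})\to\widehat Q^n(C)$ and $S^n:\widehat Q^0(C^{0-*})\to\widehat Q^n(C^{n-*})$ are isomorphisms, and for every normal structure $(\gamma,\theta)$ the class $[\gamma]\in\widehat Q^0(C^{0-*})$ is the image of $[\phi]\in Q^n(C)$ under the composite $$Q^n(C)\xrightarrow{\ J\ }\widehat Q^n(C)\xrightarrow{((\widehat\phi_0)^{\%})^{-1}}\widehat Q^n(C^{n-*})\xrightarrow{(S^n)^{-1}}\widehat Q^0(C^{0-*}).$$ -/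

import Mathlib

open CategoryTheory
open scoped DirectSum TensorProduct

universe u

set_option linter.unusedSectionVars false

noncomputable section

namespace AlgPoincare

/-! ### Modules over a ring with involution -/

section Modules

variable (A : Type u) [Ring A] [StarRing A]

/-- The dual `M^* = Hom_A(M, A)` of a left `A`-module, again regarded as a left `A`-module. -/
def InvDual (M : Type u) [AddCommGroup M] [Module A M] : Type u := M →ₗ[A] A

namespace InvDual

variable {A}
variable {M N : Type u} [AddCommGroup M] [Module A M] [AddCommGroup N] [Module A N]

instance : AddCommGroup (InvDual A M) := inferInstanceAs (AddCommGroup (M →ₗ[A] A))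

instance : FunLike (InvDual A M) M A := inferInstanceAs (FunLike (M →ₗ[A] A) M A)

@[ext] theorem ext {f g : InvDual A M} (h : ∀ x, f x = g x) : f = g := LinearMap.ext h

@[simp] theorem add_apply (f g : InvDual A M) (x : M) : (f + g) x = f x + g x := rfl

@[simp] theorem zero_apply (x : M) : (0 : InvDual A M) x = 0 := rfl

@[simp] theorem map_smul' (f : InvDual A M) (a : A) (x : M) : f (a • x) = a * f x :=
  LinearMap.map_smul (show M →ₗ[A] A from f) a x

/-- The left action of `A` on `M^*`: `(a f)(x) = f(x) * star a`. -/
instance : SMul A (InvDual A M) where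
  smul a f :=
    { toFun := fun x => f x * star a
      map_add' := fun x y => by
        have : f (x + y) = f x + f y := LinearMap.map_add (show M →ₗ[A] A from f) x y
        rw [this, add_mul]
      map_smul' := fun b x => by
        simp [mul_assoc] }

@[simp] theorem smul_apply (a : A) (f : InvDual A M) (x : M) : (a • f) x = f x * star a := rfl

instance : Module A (InvDual A M) where
  one_smul f := by ext x; simp
  mul_smul a b f := by ext x; simp [mul_assoc]
  smul_zero a := by ext x; simp
  smul_add a f g := by ext x; simp [add_mul]
  add_smul a b f := by ext x; simp [mul_add]
  zero_smul f := by ext x; simp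

/-- The dual morphism `f^* : N^* → M^*`, `g ↦ g ∘ f`. -/
def map (f : M →ₗ[A] N) : InvDual A N →ₗ[A] InvDual A M where
  toFun g := (show N →ₗ[A] A from g).comp f
  map_add' _ _ := rfl
  map_smul' _ _ := rfl

@[simp] theorem map_apply (f : M →ₗ[A] N) (g : InvDual A N) (x : M) : map f g x = g (f x) := rfl

end InvDual

/-- The subgroup of `M ⊗_ℤ N` generated by the `(star a • x) ⊗ y - x ⊗ (a • y)`. -/
def tensorTRel (M N : Type u) [AddCommGroup M] [Module A M] [AddCommGroup N] [Module A N] :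
    AddSubgroup (M ⊗[ℤ] N) :=
  AddSubgroup.closure
    {z | ∃ (a : A) (x : M) (y : N), z = (star a • x) ⊗ₜ[ℤ] y - x ⊗ₜ[ℤ] (a • y)}

/-- The abelian group `M^t ⊗_A N`, where `M^t` is the left `A`-module `M` made into a
right `A`-module by `x * a = star a • x`. -/
def TensorT (M N : Type u) [AddCommGroup M] [Module A M] [AddCommGroup N] [Module A N] :
    Type u := (M ⊗[ℤ] N) ⧸ tensorTRel A M N

namespace TensorT

variable {A}
variable {M N M' N' M'' N'' : Type u}
  [AddCommGroup M] [Module A M] [AddCommGroup N] [Module A N]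
  [AddCommGroup M'] [Module A M'] [AddCommGroup N'] [Module A N']
  [AddCommGroup M''] [Module A M''] [AddCommGroup N''] [Module A N'']

instance : AddCommGroup (TensorT A M N) :=
  inferInstanceAs (AddCommGroup ((M ⊗[ℤ] N) ⧸ tensorTRel A M N))

variable (A M N) in
/-- The projection from `M ⊗_ℤ N`. -/
def mk : M ⊗[ℤ] N →+ TensorT A M N := QuotientAddGroup.mk' (tensorTRel A M N)

variable (A) in
/-- The class of `x ⊗ y` in `M^t ⊗_A N`. -/
def tmul (x : M) (y : N) : TensorT A M N := mk A M N (x ⊗ₜ[ℤ] y)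

theorem add_tmul (x x' : M) (y : N) : tmul A (x + x') y = tmul A x y + tmul A x' y := by
  rw [tmul, TensorProduct.add_tmul, map_add]; rfl

theorem tmul_add (x : M) (y y' : N) : tmul A x (y + y') = tmul A x y + tmul A x y' := by
  rw [tmul, TensorProduct.tmul_add, map_add]; rfl

theorem smul_tmul (a : A) (x : M) (y : N) : tmul A (star a • x) y = tmul A x (a • y) := by
  rw [← sub_eq_zero, tmul, tmul, ← map_sub]
  exact (QuotientAddGroup.eq_zero_iff _).2 (AddSubgroup.subset_closure ⟨a, x, y, rfl⟩)

theorem hom_ext {P : Type*} [AddCommGroup P] {f g : TensorT A M N →+ P}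
    (h : ∀ x y, f (tmul A x y) = g (tmul A x y)) : f = g := by
  apply QuotientAddGroup.addMonoidHom_ext
  ext z
  induction z using TensorProduct.induction_on with
  | zero => simp
  | tmul x y => exact h x y
  | add z w hz hw => rw [map_add, map_add, hz, hw]

/-- The universal property of `M^t ⊗_A N`. -/
def lift {P : Type*} [AddCommGroup P] (b : M →+ N →+ P)
    (hb : ∀ (a : A) x y, b (star a • x) y = b x (a • y)) : TensorT A M N →+ P :=
  QuotientAddGroup.lift (tensorTRel A M N)
    (TensorProduct.liftAddHom b (fun r x y => by simp))
    ((AddSubgroup.closure_le _).2 (by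
      rintro _ ⟨a, x, y, rfl⟩
      simp [hb]))

@[simp] theorem lift_tmul {P : Type*} [AddCommGroup P] (b : M →+ N →+ P)
    (hb : ∀ (a : A) x y, b (star a • x) y = b x (a • y)) (x : M) (y : N) :
    lift b hb (tmul A x y) = b x y := rfl

/-- `f^t ⊗ g : x ⊗ y ↦ f(x) ⊗ g(y)`. -/
def map (f : M →ₗ[A] M') (g : N →ₗ[A] N') : TensorT A M N →+ TensorT A M' N' :=
  lift (AddMonoidHom.mk' (fun x => AddMonoidHom.mk' (fun y => tmul A (f x) (g y))
      (fun y y' => by rw [map_add, tmul_add]))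
      (fun x x' => by ext y; simp [add_tmul]))
    (fun a x y => by simp [smul_tmul])

@[simp] theorem map_tmul (f : M →ₗ[A] M') (g : N →ₗ[A] N') (x : M) (y : N) :
    map f g (tmul A x y) = tmul A (f x) (g y) := rfl

/-- The interchange `x ⊗ y ↦ y ⊗ x`. -/
def swap : TensorT A M N →+ TensorT A N M :=
  lift (AddMonoidHom.mk' (fun x => AddMonoidHom.mk' (fun y => tmul A y x)
      (fun y y' => by rw [add_tmul]))
      (fun x x' => by ext y; simp [tmul_add]))
    (fun a x y => by
      have := smul_tmul (A := A) (star a) y x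
      rw [star_star] at this
      exact this.symm)

@[simp] theorem swap_tmul (x : M) (y : N) : swap (tmul A x y) = tmul A y x := rfl

/-- The slant map `M^t ⊗_A N → Hom_A(M^*, N)`, `x ⊗ y ↦ (f ↦ star (f x) • y)`. -/
def slant : TensorT A M N →+ (InvDual A M →ₗ[A] N) :=
  lift (AddMonoidHom.mk' (fun x => AddMonoidHom.mk' (fun y =>
        { toFun := fun f => star (f x) • y
          map_add' := fun f g => by simp [add_smul]
          map_smul' := fun a f => by simp [mul_smul] })
      (fun y y' => by ext f; simp))
      (fun x x' => by
        ext y f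
        have : f (x + x') = f x + f x' := LinearMap.map_add (show M →ₗ[A] A from f) x x'
        simp [this, add_smul]))
    (fun a x y => by ext f; simp [mul_smul])

@[simp] theorem slant_tmul (x : M) (y : N) (f : InvDual A M) :
    slant (tmul A x y) f = star (f x) • y := rfl

theorem map_comp_map (f : M →ₗ[A] M') (g : N →ₗ[A] N') (f' : M' →ₗ[A] M'') (g' : N' →ₗ[A] N'')
    (z : TensorT A M N) : map f' g' (map f g z) = map (f'.comp f) (g'.comp g) z :=
  DFunLike.congr_fun (hom_ext (f := (map f' g').comp (map f g))
    (g := map (f'.comp f) (g'.comp g)) (fun _ _ => rfl)) z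

theorem map_swap (f : M →ₗ[A] M') (g : N →ₗ[A] N') (z : TensorT A M N) :
    map g f (swap z) = swap (map f g z) :=
  DFunLike.congr_fun (hom_ext (f := (map g f).comp swap)
    (g := swap.comp (map f g)) (fun _ _ => rfl)) z

theorem swap_swap (z : TensorT A M N) : swap (swap z) = z :=
  DFunLike.congr_fun (hom_ext (f := swap.comp swap)
    (g := AddMonoidHom.id (TensorT A M N)) (fun _ _ => rfl)) z

theorem map_zero_right (f : M →ₗ[A] M') (z : TensorT A M N) :
    map f (0 : N →ₗ[A] N') z = 0 :=
  DFunLike.congr_fun (hom_ext (f := map f (0 : N →ₗ[A] N'))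
    (g := 0) (fun x y => by
      have := tmul_add (A := A) (f x) (0 : N') 0
      simpa using this)) z

theorem map_zero_left (g : N →ₗ[A] N') (z : TensorT A M N) :
    map (0 : M →ₗ[A] M') g z = 0 :=
  DFunLike.congr_fun (hom_ext (f := map (0 : M →ₗ[A] M') g)
    (g := 0) (fun x y => by
      have := add_tmul (A := A) (0 : M') 0 (g y)
      simpa using this)) z

theorem slant_map (f : M →ₗ[A] M') (g : N →ₗ[A] N') (z : TensorT A M N) (h : InvDual A M') :
    slant (map f g z) h = g (slant z (InvDual.map f h)) := by
  let e : (InvDual A M' →ₗ[A] N') →+ N' := AddMonoidHom.mk' (fun k => k h) (fun _ _ => rfl)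
  let e' : (InvDual A M →ₗ[A] N) →+ N' :=
    AddMonoidHom.mk' (fun k => g (k (InvDual.map f h))) (fun _ _ => by simp)
  refine DFunLike.congr_fun (hom_ext (f := (e.comp slant).comp (map f g))
    (g := e'.comp slant) (fun x y => ?_)) z
  simp [e, e']

end TensorT

end Modules

/-! ### Chain complexes -/

section Complexes

variable {A : Type u} [Ring A] [StarRing A]

/-- `D` is strictly `n`-dimensional: f.g. projective modules, zero outside degrees `0, …, n`. -/
def IsStrictlyDimensional (D : ChainComplex (ModuleCat.{u} A) ℤ) (n : ℕ) : Prop :=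
  (∀ r : ℤ, Module.Finite A (D.X r) ∧ Module.Projective A (D.X r)) ∧
    ∀ r : ℤ, (r < 0 ∨ (n : ℤ) < r) → Subsingleton (D.X r)

/-- `C` is `n`-dimensional: it has the chain homotopy type of a strictly `n`-dimensional
chain complex. -/
def IsDimensional (C : ChainComplex (ModuleCat.{u} A) ℤ) (n : ℕ) : Prop :=
  ∃ D : ChainComplex (ModuleCat.{u} A) ℤ,
    IsStrictlyDimensional D n ∧ Nonempty (HomotopyEquiv C D)

/-- The `n`-dual `C^{n-*}`: in degree `r` it is `(C_{n-r})^*`, with differential `(-1)^r (d_C)^*`. -/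
def nDual (C : ChainComplex (ModuleCat.{u} A) ℤ) (n : ℤ) : ChainComplex (ModuleCat.{u} A) ℤ where
  X r := ModuleCat.of A (InvDual A (C.X (n - r)))
  d i j := ModuleCat.ofHom (i.negOnePow • InvDual.map (C.d (n - j) (n - i)).hom)
  shape i j hij := by
    rw [C.shape (n - j) (n - i) (by simp only [ComplexShape.down_Rel] at hij ⊢; omega)]
    have : InvDual.map (0 : C.X (n - j) →ₗ[A] C.X (n - i)) = 0 := by
      ext g x
      exact LinearMap.map_zero (show C.X (n - i) →ₗ[A] A from g)
    simp [this]
  d_comp_d' i j k _ _ := by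
    have h : (C.d (n - j) (n - i)).hom.comp (C.d (n - k) (n - j)).hom = 0 := by
      rw [← ModuleCat.hom_comp, C.d_comp_d]; rfl
    have h' : (InvDual.map (C.d (n - k) (n - j)).hom).comp
        (InvDual.map (C.d (n - j) (n - i)).hom) = 0 := by
      ext g x
      have hx := LinearMap.congr_fun h x
      simp only [LinearMap.comp_apply, LinearMap.zero_apply] at hx
      simp only [LinearMap.comp_apply, InvDual.map_apply, hx]
      exact LinearMap.map_zero (show C.X (n - i) →ₗ[A] A from g)
    rw [← ModuleCat.ofHom_comp, LinearMap.comp_smul, LinearMap.smul_comp, h']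
    simp

/-- The `n`-fold suspension: `(S^n C)_r = C_{r-n}` with the same differential. -/
def suspension (C : ChainComplex (ModuleCat.{u} A) ℤ) (n : ℤ) :
    ChainComplex (ModuleCat.{u} A) ℤ where
  X r := C.X (r - n)
  d i j := C.d (i - n) (j - n)
  shape i j hij := C.shape _ _ (by simp only [ComplexShape.down_Rel] at hij ⊢; omega)
  d_comp_d' i j k _ _ := C.d_comp_d _ _ _

/-- The isomorphism `S^n(C^{0-*}) → C^{n-*}`, which is `x ↦ (-1)^{nr} x` in degree `r`. -/
def suspensionDual (C : ChainComplex (ModuleCat.{u} A) ℤ) (n : ℤ) :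
    suspension (nDual C 0) n ⟶ nDual C n where
  f r := ModuleCat.ofHom ((n * r).negOnePow •
    InvDual.map (C.XIsoOfEq (show n - r = 0 - (r - n) by omega)).hom.hom)
  comm' i j hij := by
    have hij' : j + 1 = i := hij
    have key : (InvDual.map (C.d (n - j) (n - i)).hom).comp
          (InvDual.map (C.XIsoOfEq (show n - i = 0 - (i - n) by omega)).hom.hom) =
        (InvDual.map (C.XIsoOfEq (show n - j = 0 - (j - n) by omega)).hom.hom).comp
          (InvDual.map (C.d (0 - (j - n)) (0 - (i - n))).hom) := by
      have h : C.d (n - j) (n - i) ≫ (C.XIsoOfEq (show n - i = 0 - (i - n) by omega)).hom =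
          (C.XIsoOfEq (show n - j = 0 - (j - n) by omega)).hom ≫
            C.d (0 - (j - n)) (0 - (i - n)) := by
        simp
      ext g x
      simp only [LinearMap.comp_apply, InvDual.map_apply]
      have := ConcreteCategory.congr_hom h x
      exact congrArg g this
    apply ModuleCat.hom_ext
    simp only [nDual, suspension, ModuleCat.hom_comp, ModuleCat.hom_ofHom]
    rw [LinearMap.comp_smul, LinearMap.smul_comp, LinearMap.comp_smul, LinearMap.smul_comp, key,
      smul_smul, smul_smul]
    congr 1
    rw [← Int.negOnePow_add, ← Int.negOnePow_add, Int.negOnePow_eq_iff]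
    subst hij'
    exact ⟨n, by ring⟩

/-! ### The complex `C^t ⊗_A C` -/

/-- `(C^t ⊗_A C)_k`, the direct sum of the `C_p^t ⊗_A C_q` over all `p + q = k`. -/
abbrev Tens (C : ChainComplex (ModuleCat.{u} A) ℤ) (k : ℤ) : Type u :=
  ⨁ i : {i : ℤ × ℤ // i.1 + i.2 = k}, TensorT A (C.X i.1.1) (C.X i.1.2)

/-- The summand inclusion `C_p^t ⊗_A C_q → (C^t ⊗_A C)_k` for `p + q = k`. -/
def Tens.of (C : ChainComplex (ModuleCat.{u} A) ℤ) (p q k : ℤ) (h : p + q = k) :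
    TensorT A (C.X p) (C.X q) →+ Tens C k :=
  DirectSum.of (fun i : {i : ℤ × ℤ // i.1 + i.2 = k} => TensorT A (C.X i.1.1) (C.X i.1.2))
    ⟨(p, q), h⟩

/-- The differential `d(x ⊗ y) = x ⊗ d y + (-1)^q d x ⊗ y`, `q = deg y`. -/
def tensD (C : ChainComplex (ModuleCat.{u} A) ℤ) (k : ℤ) : Tens C (k + 1) →+ Tens C k :=
  DirectSum.toAddMonoid fun i =>
    (Tens.of C i.1.1 (i.1.2 - 1) k (by have := i.2; omega)).comp
        (TensorT.map LinearMap.id (C.d i.1.2 (i.1.2 - 1)).hom) +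
      i.1.2.negOnePow • (Tens.of C (i.1.1 - 1) i.1.2 k (by have := i.2; omega)).comp
        (TensorT.map (C.d i.1.1 (i.1.1 - 1)).hom LinearMap.id)

/-- The transposition `T(x ⊗ y) = (-1)^{pq} y ⊗ x`, `p = deg x`, `q = deg y`. -/
def tensT (C : ChainComplex (ModuleCat.{u} A) ℤ) (k : ℤ) : Tens C k →+ Tens C k :=
  DirectSum.toAddMonoid fun i =>
    (i.1.1 * i.1.2).negOnePow •
      (Tens.of C i.1.2 i.1.1 k (by have := i.2; omega)).comp TensorT.swap

/-- `f^t ⊗ f : C^t ⊗_A C → D^t ⊗_A D` for a chain map `f : C → D`. -/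
def tensMap {C D : ChainComplex (ModuleCat.{u} A) ℤ} (f : C ⟶ D) (k : ℤ) :
    Tens C k →+ Tens D k :=
  DirectSum.map fun i => TensorT.map (f.f i.1.1).hom (f.f i.1.2).hom

/-- The regrading `C^t ⊗_A C → (S^n C)^t ⊗_A (S^n C)` which is the identity
`C_{p-n}^t ⊗_A C_{q-n} = (S^n C)_p^t ⊗_A (S^n C)_q` on each summand. -/
def tensRegrade (C : ChainComplex (ModuleCat.{u} A) ℤ) (n k : ℤ) :
    Tens C (k - 2 * n) →+ Tens (suspension C n) k :=
  let h : {i : ℤ × ℤ // i.1 + i.2 = k} → {i : ℤ × ℤ // i.1 + i.2 = k - 2 * n} :=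
    fun i => ⟨(i.1.1 - n, i.1.2 - n), by have := i.2; simp only; omega⟩
  have hh : Function.Injective h := fun i j hij => by
    have h1 : i.1.1 - n = j.1.1 - n := congrArg (fun x => x.1.1) hij
    have h2 : i.1.2 - n = j.1.2 - n := congrArg (fun x => x.1.2) hij
    exact Subtype.ext (Prod.ext (by omega) (by omega))
  { toFun := fun z => DFinsupp.comapDomain h hh z
    map_zero' := DFinsupp.comapDomain_zero h hh
    map_add' := DFinsupp.comapDomain_add h hh }

/-- The map `C^t ⊗_A C → (S^n C)^t ⊗_A (S^n C)`, of degree `2n`, sending `x ⊗ y` to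
`(-1)^{np} x ⊗ y` with `p` the degree of `x` in `S^n C`. The sign makes it commute with the
differentials. -/
def tensSusp (C : ChainComplex (ModuleCat.{u} A) ℤ) (n k : ℤ) :
    Tens C (k - 2 * n) →+ Tens (suspension C n) k :=
  (DirectSum.map fun i => (n * i.1.1).negOnePow •
    AddMonoidHom.id (TensorT A ((suspension C n).X i.1.1) ((suspension C n).X i.1.2))).comp
    (tensRegrade C n k)

theorem units_smul_directSum_apply {ι : Type*} {β : ι → Type*} [∀ i, AddCommGroup (β i)]
    (c : ℤˣ) (z : ⨁ i, β i) (i : ι) : (c • z) i = c • z i := by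
  rcases Int.units_eq_one_or c with rfl | rfl
  · simp
  · simp only [Units.neg_smul, one_smul]
    exact map_neg (DFinsupp.evalAddMonoidHom i) z

theorem map_units_smul' {G H : Type*} [AddCommGroup G] [AddCommGroup H] (f : G →+ H) (c : ℤˣ)
    (x : G) : f (c • x) = c • f x := by
  rw [Units.smul_def, map_zsmul, Units.smul_def]

theorem tensD_apply (C : ChainComplex (ModuleCat.{u} A) ℤ) (k p q p' q' : ℤ) (h : p + q = k)
    (hp : p + 1 = p') (hq : q + 1 = q') (z : Tens C (k + 1)) :
    tensD C k z ⟨(p, q), h⟩ =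
      TensorT.map LinearMap.id (C.d q' q).hom (z ⟨(p, q'), by simp only; omega⟩) +
      q.negOnePow •
        TensorT.map (C.d p' p).hom LinearMap.id (z ⟨(p', q), by simp only; omega⟩) := by
  induction z using DirectSum.induction_on with
  | zero => simp
  | add x y hx hy => simp only [map_add, DirectSum.add_apply, hx, hy, smul_add]; abel
  | of i x =>
    obtain ⟨⟨a, b⟩, hab⟩ := i
    simp only at hab
    rw [tensD, DirectSum.toAddMonoid_of, AddMonoidHom.add_apply, DirectSum.add_apply]
    congr 1
    · simp only [Tens.of, AddMonoidHom.comp_apply]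
      by_cases hb : b = q'
      · obtain rfl : a = p := by omega
        subst hb
        obtain rfl : q = b - 1 := by omega
        rw [DirectSum.of_eq_same, DirectSum.of_eq_same]
      · rw [DirectSum.of_eq_of_ne, DirectSum.of_eq_of_ne, map_zero]
        · intro e; exact hb (congrArg (fun x => x.1.2) e).symm
        · intro e
          have := congrArg (fun x => x.1.2) e
          simp only at this; omega
    · simp only [Tens.of, AddMonoidHom.comp_apply, AddMonoidHom.smul_apply]
      by_cases hb : a = p'
      · obtain rfl : b = q := by omega
        subst hb
        obtain rfl : p = a - 1 := by omega
        rw [units_smul_directSum_apply, DirectSum.of_eq_same, DirectSum.of_eq_same]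
      · rw [units_smul_directSum_apply, DirectSum.of_eq_of_ne, DirectSum.of_eq_of_ne, map_zero, smul_zero, smul_zero]
        · intro e; exact hb (congrArg (fun x => x.1.1) e).symm
        · intro e
          have := congrArg (fun x => x.1.1) e
          simp only at this; omega

theorem tensT_apply (C : ChainComplex (ModuleCat.{u} A) ℤ) (k p q : ℤ) (h : p + q = k)
    (z : Tens C k) :
    tensT C k z ⟨(p, q), h⟩ =
      (p * q).negOnePow • TensorT.swap (z ⟨(q, p), by simp only; omega⟩) := by
  induction z using DirectSum.induction_on with
  | zero => simp
  | add x y hx hy => simp only [map_add, DirectSum.add_apply, hx, hy, smul_add]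
  | of i x =>
    obtain ⟨⟨a, b⟩, hab⟩ := i
    simp only at hab
    rw [tensT, DirectSum.toAddMonoid_of]
    simp only [Tens.of, AddMonoidHom.comp_apply, AddMonoidHom.smul_apply]
    by_cases hb : a = q
    · obtain rfl : b = p := by omega
      subst hb
      rw [units_smul_directSum_apply, DirectSum.of_eq_same, DirectSum.of_eq_same, mul_comm]
    · rw [units_smul_directSum_apply, DirectSum.of_eq_of_ne, DirectSum.of_eq_of_ne, map_zero, smul_zero, smul_zero]
      · intro e; exact hb (congrArg (fun x => x.1.1) e).symm
      · intro e
        have := congrArg (fun x => x.1.2) e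
        simp only at this; omega

theorem tensMap_apply {C D : ChainComplex (ModuleCat.{u} A) ℤ} (f : C ⟶ D) (k p q : ℤ)
    (h : p + q = k) (z : Tens C k) :
    tensMap f k z ⟨(p, q), h⟩ = TensorT.map (f.f p).hom (f.f q).hom (z ⟨(p, q), h⟩) := by
  simp [tensMap]

theorem tensSusp_apply (C : ChainComplex (ModuleCat.{u} A) ℤ) (n k p q : ℤ) (h : p + q = k)
    (z : Tens C (k - 2 * n)) :
    tensSusp C n k z ⟨(p, q), h⟩ =
      (n * p).negOnePow • (z ⟨(p - n, q - n), by simp only; omega⟩ :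
        TensorT A (C.X (p - n)) (C.X (q - n))) := by
  rw [tensSusp, AddMonoidHom.comp_apply, DirectSum.map_apply]
  rfl

/-! ### Symmetric and hyperquadratic structures -/

/-- The chain group `(Ŵ^% C)_m = Hom_{ℤ[ℤ/2]}(Ŵ, C^t ⊗_A C)_m`, for any degree `m`. A chain is a
collection `θ_s ∈ (C^t ⊗_A C)_{m+s}`, `s ∈ ℤ`; here `θ_s` is stored at its degree `k = m + s`,
so that the underlying group is `∏_k (C^t ⊗_A C)_k` for every `m`. -/
abbrev HatChain (C : ChainComplex (ModuleCat.{u} A) ℤ) : Type u := ∀ k : ℤ, Tens C k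

/-- The differential `(Ŵ^% C)_m → (Ŵ^% C)_{m-1}`,
`(dθ)_s = d θ_s + (-1)^{m+s-1} (θ_{s-1} + (-1)^s T θ_{s-1})`.
At degree `k = (m - 1) + s` one has `θ_s = θ (k + 1)`, `θ_{s-1} = θ k` and `s = k - m + 1`. -/
def hatD (C : ChainComplex (ModuleCat.{u} A) ℤ) (m : ℤ) : HatChain C →+ HatChain C where
  toFun θ k := tensD C k (θ (k + 1)) +
    k.negOnePow • (θ k + (k - m + 1).negOnePow • tensT C k (θ k))
  map_zero' := by ext k : 1; simp
  map_add' θ θ' := by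
    ext k : 1
    simp only [Pi.add_apply, map_add, smul_add]
    abel

/-- An equivalence `ν : θ → θ'` of `m`-dimensional hyperquadratic structures:
`ν ∈ (Ŵ^% C)_{m+1}` with `θ' - θ = d ν`. -/
def IsHatEquivalence (C : ChainComplex (ModuleCat.{u} A) ℤ) (m : ℤ) (ν θ θ' : HatChain C) : Prop :=
  θ' - θ = hatD C (m + 1) ν

/-- The map `f̂^% : Ŵ^% C → Ŵ^% D` induced by a chain map `f`. -/
def hatMap {C D : ChainComplex (ModuleCat.{u} A) ℤ} (f : C ⟶ D) : HatChain C →+ HatChain D where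
  toFun θ k := tensMap f k (θ k)
  map_zero' := by ext k : 1; simp
  map_add' θ θ' := by ext k : 1; simp

/-- The suspension `S^n : (Ŵ^% C)_m → (Ŵ^% (S^n C))_{m+n}`, `(S^n θ)_s = θ_{s-n}`. At degree
`k = m + n + s` of `S^n C` the chain `θ_{s-n}` has degree `k - 2n` in `C`. -/
def hatSusp (C : ChainComplex (ModuleCat.{u} A) ℤ) (n : ℤ) :
    HatChain C →+ HatChain (suspension C n) where
  toFun θ k := tensSusp C n k (θ (k - 2 * n))
  map_zero' := by ext k : 1; simp
  map_add' θ θ' := by ext k : 1; simp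

/-- The suspension `S^n : (Ŵ^% C^{0-*})_m → (Ŵ^% C^{n-*})_{m+n}`, using the isomorphism
`S^n(C^{0-*}) ≅ C^{n-*}`. -/
def dualSusp (C : ChainComplex (ModuleCat.{u} A) ℤ) (n : ℤ) :
    HatChain (nDual C 0) →+ HatChain (nDual C n) :=
  (hatMap (suspensionDual C n)).comp (hatSusp (nDual C 0) n)

/-- The component in `C_p^t ⊗_A C_q`. -/
def HatChain.comp {C : ChainComplex (ModuleCat.{u} A) ℤ} (θ : HatChain C) (p q : ℤ) :
    TensorT A (C.X p) (C.X q) := θ (p + q) ⟨(p, q), rfl⟩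

theorem HatChain.apply_eq {C : ChainComplex (ModuleCat.{u} A) ℤ} (θ : HatChain C) (k p q : ℤ)
    (h : p + q = k) : θ k ⟨(p, q), h⟩ = θ.comp p q := by
  subst h; rfl

theorem HatChain.ext_comp {C : ChainComplex (ModuleCat.{u} A) ℤ} {θ θ' : HatChain C}
    (h : ∀ p q, θ.comp p q = θ'.comp p q) : θ = θ' := by
  ext k : 1
  refine DirectSum.ext fun i => ?_
  obtain ⟨⟨p, q⟩, hi⟩ := i
  rw [HatChain.apply_eq, HatChain.apply_eq, h]

theorem hatD_comp (C : ChainComplex (ModuleCat.{u} A) ℤ) (m p q p' q' : ℤ)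
    (hp : p + 1 = p') (hq : q + 1 = q') (θ : HatChain C) :
    (hatD C m θ).comp p q =
      TensorT.map LinearMap.id (C.d q' q).hom (θ.comp p q') +
      q.negOnePow • TensorT.map (C.d p' p).hom LinearMap.id (θ.comp p' q) +
      (p + q).negOnePow • (θ.comp p q + (p + q - m + 1).negOnePow •
        (p * q).negOnePow • TensorT.swap (θ.comp q p)) := by
  change (tensD C (p + q) (θ (p + q + 1)) +
    (p + q).negOnePow • (θ (p + q) + (p + q - m + 1).negOnePow • tensT C (p + q) (θ (p + q)))
      : Tens C (p + q)) ⟨(p, q), rfl⟩ = _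
  simp only [DirectSum.add_apply, units_smul_directSum_apply]
  rw [tensD_apply C _ p q p' q' rfl hp hq, tensT_apply]
  simp only [HatChain.apply_eq]

theorem hatMap_comp {C D : ChainComplex (ModuleCat.{u} A) ℤ} (f : C ⟶ D) (θ : HatChain C)
    (p q : ℤ) : (hatMap f θ).comp p q = TensorT.map (f.f p).hom (f.f q).hom (θ.comp p q) :=
  tensMap_apply f _ p q rfl _

/-- The component in `(S^n C)_p^t ⊗_A (S^n C)_q = C_{p-n}^t ⊗_A C_{q-n}`. -/
def HatChain.suspComp {C : ChainComplex (ModuleCat.{u} A) ℤ} (n : ℤ) (θ : HatChain C) (p q : ℤ) :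
    TensorT A ((suspension C n).X p) ((suspension C n).X q) := θ.comp (p - n) (q - n)

theorem hatSusp_comp (C : ChainComplex (ModuleCat.{u} A) ℤ) (n : ℤ) (θ : HatChain C)
    (p q : ℤ) : (hatSusp C n θ).comp p q = (n * p).negOnePow • θ.suspComp n p q := by
  have := tensSusp_apply C n (p + q) p q rfl (θ (p + q - 2 * n))
  rw [HatChain.apply_eq] at this
  exact this

/-- `f̂^%` is a chain map. -/
theorem hatMap_hatD {C D : ChainComplex (ModuleCat.{u} A) ℤ} (f : C ⟶ D) (m : ℤ)
    (θ : HatChain C) : hatMap f (hatD C m θ) = hatD D m (hatMap f θ) := by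
  have hf : ∀ i j, (f.f j).hom.comp (C.d i j).hom = (D.d i j).hom.comp (f.f i).hom := by
    intro i j
    rw [← ModuleCat.hom_comp, ← ModuleCat.hom_comp, f.comm]
  refine HatChain.ext_comp fun p q => ?_
  simp only [hatMap_comp, hatD_comp _ m p q _ _ rfl rfl, map_add, Units.smul_def, map_zsmul,
    TensorT.map_comp_map, hf, LinearMap.comp_id, LinearMap.id_comp,
    ← TensorT.map_swap]

/-- `S^n` is a chain map. -/
theorem hatSusp_hatD (C : ChainComplex (ModuleCat.{u} A) ℤ) (n m m' : ℤ) (hm : m' = m + n)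
    (θ : HatChain C) :
    hatSusp C n (hatD C m θ) = hatD (suspension C n) m' (hatSusp C n θ) := by
  have e : ∀ {a b : ℤ}, Even (a - b) → a.negOnePow = b.negOnePow :=
    fun h => (Int.negOnePow_eq_iff _ _).2 h
  refine HatChain.ext_comp fun p q => ?_
  have key : (hatD C m θ).suspComp n p q =
      TensorT.map LinearMap.id ((suspension C n).d (q + 1) q).hom (θ.suspComp n p (q + 1)) +
      (q - n).negOnePow •
        TensorT.map ((suspension C n).d (p + 1) p).hom LinearMap.id (θ.suspComp n (p + 1) q) +
      (p - n + (q - n)).negOnePow • (θ.suspComp n p q + (p - n + (q - n) - m + 1).negOnePow •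
        ((p - n) * (q - n)).negOnePow • TensorT.swap (θ.suspComp n q p)) :=
    hatD_comp C m (p - n) (q - n) (p + 1 - n) (q + 1 - n) (by ring) (by ring) θ
  rw [hatSusp_comp, key, hatD_comp _ m' p q _ _ rfl rfl]
  simp only [hatSusp_comp, map_units_smul', smul_add, smul_smul, ← Int.negOnePow_add]
  congr 1
  · congr 1
    congr 1
    exact e ⟨-n, by ring⟩
  · congr 1
    · congr 1
      exact e ⟨-n, by ring⟩
    · congr 1
      obtain ⟨c, hc⟩ := Int.even_mul_succ_self n
      refine e ⟨c - n * q - 2 * n, ?_⟩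
      subst hm
      linear_combination hc

/-- `S^n : Ŵ^% C^{0-*} → Ŵ^% C^{n-*}` is a chain map. -/
theorem dualSusp_hatD (C : ChainComplex (ModuleCat.{u} A) ℤ) (n m m' : ℤ) (hm : m' = m + n)
    (θ : HatChain (nDual C 0)) :
    dualSusp C n (hatD (nDual C 0) m θ) = hatD (nDual C n) m' (dualSusp C n θ) := by
  rw [dualSusp, AddMonoidHom.comp_apply, hatSusp_hatD _ n m m' hm, hatMap_hatD]
  rfl

theorem hatD_hatD (C : ChainComplex (ModuleCat.{u} A) ℤ) (m : ℤ) (θ : HatChain C) :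
    hatD C m (hatD C (m + 1) θ) = 0 := by
  have hd : ∀ i j k, (C.d j k).hom.comp (C.d i j).hom = 0 := by
    intro i j k
    rw [← ModuleCat.hom_comp, C.d_comp_d]; rfl
  refine HatChain.ext_comp fun p q => ?_
  rw [show (0 : HatChain C).comp p q = 0 from rfl, hatD_comp C m p q _ _ rfl rfl,
    hatD_comp C (m + 1) p (q + 1) _ _ rfl rfl, hatD_comp C (m + 1) (p + 1) q _ _ rfl rfl,
    hatD_comp C (m + 1) p q _ _ rfl rfl, hatD_comp C (m + 1) q p _ _ rfl rfl]
  simp only [map_add, map_units_smul', smul_add, smul_smul, ← Int.negOnePow_add,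
    TensorT.map_comp_map, TensorT.swap_swap, hd, LinearMap.comp_id, LinearMap.id_comp,
    TensorT.map_zero_left, TensorT.map_zero_right, ← TensorT.map_swap]
  have hp : ∀ a : ℤ, a.negOnePow = if Even a then 1 else -1 := fun a => by
    split_ifs with h
    · exact Int.negOnePow_even a h
    · exact Int.negOnePow_odd a (Int.not_even_iff_odd.1 h)
  by_cases h1 : Even p <;> by_cases h2 : Even q <;> by_cases h3 : Even m <;>
    simp only [hp, Int.even_add, Int.even_sub, Int.even_mul, Int.not_even_one, h1, h2, h3,
      iff_true, iff_false, not_true_eq_false, or_self,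
      or_true, or_false, if_true, if_false, one_smul, Units.neg_smul, smul_zero, zero_add,
      add_zero] <;> abel

/-- The `m`-dimensional hyperquadratic structures on `C`: the cycles of `(Ŵ^% C)_m`. -/
def hatCycles (C : ChainComplex (ModuleCat.{u} A) ℤ) (m : ℤ) : AddSubgroup (HatChain C) :=
  (hatD C m).ker

/-- The boundaries in `(Ŵ^% C)_m`. -/
def hatBoundaries (C : ChainComplex (ModuleCat.{u} A) ℤ) (m : ℤ) : AddSubgroup (HatChain C) :=
  (hatD C (m + 1)).range

/-- `Q̂^m(C) = H_m(Ŵ^% C)`. -/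
abbrev HatQ (C : ChainComplex (ModuleCat.{u} A) ℤ) (m : ℤ) : Type u :=
  hatCycles C m ⧸ (hatBoundaries C m).addSubgroupOf (hatCycles C m)

/-- The class in `Q̂^m(C)` of a hyperquadratic structure. -/
def HatQ.mk (C : ChainComplex (ModuleCat.{u} A) ℤ) (m : ℤ) : hatCycles C m →+ HatQ C m :=
  QuotientAddGroup.mk' _

/-- The chain group `(W^% C)_m = Hom_{ℤ[ℤ/2]}(W, C^t ⊗_A C)_m` of the collections
`φ_s ∈ (C^t ⊗_A C)_{m+s}`, `s ≥ 0`. It is regarded as the group of those collections indexed by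
all `s ∈ ℤ` which have `φ_s = 0` for `s < 0`; the map `J : W^% C → Ŵ^% C` is then the inclusion,
and the differential `(dφ)_s = d φ_s + (-1)^{m+s-1} (φ_{s-1} + (-1)^s T φ_{s-1})`, `φ_{-1} = 0`,
is the restriction of `hatD`. -/
def symChains (C : ChainComplex (ModuleCat.{u} A) ℤ) (m : ℤ) : AddSubgroup (HatChain C) where
  carrier := {φ | ∀ k, k < m → φ k = 0}
  zero_mem' _ _ := rfl
  add_mem' h h' k hk := by rw [Pi.add_apply, h k hk, h' k hk, add_zero]
  neg_mem' h k hk := by rw [Pi.neg_apply, h k hk, neg_zero]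

/-- The `m`-dimensional symmetric structures on `C`: the cycles of `(W^% C)_m`. -/
def symCycles (C : ChainComplex (ModuleCat.{u} A) ℤ) (m : ℤ) : AddSubgroup (HatChain C) :=
  symChains C m ⊓ (hatD C m).ker

/-- The boundaries in `(W^% C)_m`. -/
def symBoundaries (C : ChainComplex (ModuleCat.{u} A) ℤ) (m : ℤ) : AddSubgroup (HatChain C) :=
  (symChains C (m + 1)).map (hatD C (m + 1))

/-- `Q^m(C) = H_m(W^% C)`. -/
abbrev SymQ (C : ChainComplex (ModuleCat.{u} A) ℤ) (m : ℤ) : Type u :=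
  symCycles C m ⧸ (symBoundaries C m).addSubgroupOf (symCycles C m)

/-- The class in `Q^m(C)` of a symmetric structure. -/
def SymQ.mk (C : ChainComplex (ModuleCat.{u} A) ℤ) (m : ℤ) : symCycles C m →+ SymQ C m :=
  QuotientAddGroup.mk' _

theorem symCycles_le (C : ChainComplex (ModuleCat.{u} A) ℤ) (m : ℤ) :
    symCycles C m ≤ hatCycles C m := inf_le_right

theorem symBoundaries_le (C : ChainComplex (ModuleCat.{u} A) ℤ) (m : ℤ) :
    symBoundaries C m ≤ hatBoundaries C m := by
  rintro _ ⟨x, _, rfl⟩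
  exact ⟨x, rfl⟩

theorem hatBoundaries_le (C : ChainComplex (ModuleCat.{u} A) ℤ) (m : ℤ) :
    hatBoundaries C m ≤ hatCycles C m := by
  rintro _ ⟨x, rfl⟩
  exact hatD_hatD C m x

theorem symBoundaries_le_symCycles (C : ChainComplex (ModuleCat.{u} A) ℤ) (m : ℤ) :
    symBoundaries C m ≤ symCycles C m := by
  rintro _ ⟨x, hx, rfl⟩
  refine ⟨fun k hk => ?_, hatD_hatD C m x⟩
  change tensD C k (x (k + 1)) + _ • (x k + _ • tensT C k (x k)) = 0
  rw [hx (k + 1) (by omega), hx k (by omega)]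
  simp

/-- `J : Q^m(C) → Q̂^m(C)`. -/
def qJ (C : ChainComplex (ModuleCat.{u} A) ℤ) (m : ℤ) : SymQ C m →+ HatQ C m :=
  QuotientAddGroup.map _ _ (AddSubgroup.inclusion (symCycles_le C m))
    (fun _ hx => symBoundaries_le C m hx)

/-- The homomorphism of homology groups induced by a homomorphism commuting with differentials. -/
def HatQ.map {C D : ChainComplex (ModuleCat.{u} A) ℤ} {m m' : ℤ} (F : HatChain C →+ HatChain D)
    (h0 : ∀ θ, F (hatD C m θ) = hatD D m' (F θ))
    (h1 : ∀ θ, F (hatD C (m + 1) θ) = hatD D (m' + 1) (F θ)) : HatQ C m →+ HatQ D m' :=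
  QuotientAddGroup.map _ _
    ((F.comp (hatCycles C m).subtype).codRestrict (hatCycles D m') (fun θ => by
      have h : hatD C m θ = 0 := θ.2
      change hatD D m' (F θ) = 0
      rw [← h0, h, map_zero]))
    (by
      rintro θ ⟨x, hx⟩
      refine ⟨F x, ?_⟩
      rw [← h1, hx]
      rfl)

/-- The homomorphism `f̂^% : Q̂^m(C) → Q̂^m(D)` induced by a chain map `f`. -/
def qMap {C D : ChainComplex (ModuleCat.{u} A) ℤ} (f : C ⟶ D) (m : ℤ) : HatQ C m →+ HatQ D m :=
  HatQ.map (hatMap f) (hatMap_hatD f m) (hatMap_hatD f (m + 1))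

/-- The homomorphism `S^n : Q̂^0(C^{0-*}) → Q̂^n(C^{n-*})`. -/
def qSusp (C : ChainComplex (ModuleCat.{u} A) ℤ) (n : ℤ) :
    HatQ (nDual C 0) 0 →+ HatQ (nDual C n) n :=
  HatQ.map (dualSusp C n) (dualSusp_hatD C n 0 n (by ring))
    (dualSusp_hatD C n (0 + 1) (n + 1) (by ring))

/-! ### Symmetric Poincaré complexes and normal structures -/

theorem units_smul_linearMap_apply {M N : Type*} [AddCommGroup M] [Module A M] [AddCommGroup N]
    [Module A N] (c : ℤˣ) (f : M →ₗ[A] N) (x : M) : (c • f) x = c • f x := by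
  rcases Int.units_eq_one_or c with rfl | rfl <;> simp

/-- The chain map `φ_0 : C^{n-*} → C` of an `n`-dimensional symmetric structure `φ`, given in
degree `r` by the slant `C_{n-r}^t ⊗_A C_r → Hom_A((C_{n-r})^*, C_r)`. -/
def dualityMap {C : ChainComplex (ModuleCat.{u} A) ℤ} {n : ℤ} (φ : symCycles C n) :
    nDual C n ⟶ C where
  f r := ModuleCat.ofHom (TensorT.slant (φ.1 n ⟨(n - r, r), by simp⟩))
  comm' i j hij := by
    have hij' : j + 1 = i := hij
    subst hij'
    have hc : hatD C n φ.1 = 0 := φ.2.2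
    have hz : φ.1.comp (n - (j + 1)) j = 0 := by
      have := φ.2.1 (n - 1) (by omega)
      rw [← HatChain.apply_eq φ.1 (n - 1) _ _ (by omega), this, DirectSum.zero_apply]
    have hz' : φ.1.comp j (n - (j + 1)) = 0 := by
      have := φ.2.1 (n - 1) (by omega)
      rw [← HatChain.apply_eq φ.1 (n - 1) _ _ (by omega), this, DirectSum.zero_apply]
    have key := hatD_comp C n (n - (j + 1)) j (n - j) (j + 1) (by ring) rfl φ.1
    rw [hc, hz, hz', show (0 : HatChain C).comp (n - (j + 1)) j = 0 from rfl] at key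
    simp only [map_zero, smul_zero, add_zero] at key
    apply ModuleCat.hom_ext
    ext g
    let ev : (InvDual A (C.X (n - (j + 1))) →ₗ[A] C.X j) →+ C.X j :=
      AddMonoidHom.mk' (fun k => k g) (fun _ _ => rfl)
    have key' := congrArg (fun z => ev (TensorT.slant z)) key
    simp only [map_add, map_zero, map_units_smul'] at key'
    have e1 : ∀ z, ev (TensorT.slant (TensorT.map LinearMap.id (C.d (j + 1) j).hom z)) =
        (C.d (j + 1) j).hom (TensorT.slant z g) := fun z => TensorT.slant_map _ _ z g
    have e2 : ∀ z, ev (TensorT.slant (TensorT.map (C.d (n - j) (n - (j + 1))).hom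
        LinearMap.id z)) =
        TensorT.slant z (InvDual.map (C.d (n - j) (n - (j + 1))).hom g) :=
      fun z => TensorT.slant_map _ _ z g
    rw [e1, e2] at key'
    simp only [HatChain.apply_eq]
    have e3 := units_smul_linearMap_apply (j + 1).negOnePow
      (InvDual.map (C.d (n - j) (n - (j + 1))).hom) g
    refine Eq.trans ?_ (congrArg (TensorT.slant (φ.1.comp (n - j) j)) e3).symm
    refine Eq.trans ?_ (map_units_smul' (TensorT.slant (φ.1.comp (n - j) j)).toAddMonoidHom
      (j + 1).negOnePow (InvDual.map (C.d (n - j) (n - (j + 1))).hom g)).symm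
    rw [Int.negOnePow_succ, Units.neg_smul]
    exact eq_neg_of_add_eq_zero_left key'.symm

/-- The symmetric complex `(C, φ)` is Poincaré: `φ_0 : C^{n-*} → C` is a chain equivalence. -/
def IsPoincare {C : ChainComplex (ModuleCat.{u} A) ℤ} {n : ℤ} (φ : symCycles C n) : Prop :=
  ∃ e : HomotopyEquiv (nDual C n) C, e.hom = dualityMap φ

/-- A normal structure `(γ, θ)` on `(C, φ)`: a bundle `γ`, that is a `0`-dimensional
hyperquadratic structure on `C^{0-*}`, and an equivalence
`θ : J(φ) → (φ̂_0)^%(S^n γ)` of `n`-dimensional hyperquadratic structures on `C`. -/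
structure NormalStructure {C : ChainComplex (ModuleCat.{u} A) ℤ} {n : ℤ} (φ : symCycles C n) where
  γ : hatCycles (nDual C 0) 0
  θ : HatChain C
  equiv : IsHatEquivalence C n θ φ.1 (hatMap (dualityMap φ) (dualSusp C n γ.1))

/-- An equivalence `(χ, η) : (γ, θ) → (γ', θ')` of normal structures on `(C, φ)`: an equivalence
of bundles `χ : γ → γ'` and an equivalence `η : θ - θ' + (φ̂_0)^%(S^n χ) → 0` of
`(n+1)`-dimensional hyperquadratic structures on `C`. -/
structure NormalStructure.Equivalence {C : ChainComplex (ModuleCat.{u} A) ℤ} {n : ℤ}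
    {φ : symCycles C n} (N N' : NormalStructure φ) where
  χ : HatChain (nDual C 0)
  bundleEquiv : IsHatEquivalence (nDual C 0) 0 χ N.γ.1 N'.γ.1
  η : HatChain C
  equiv : IsHatEquivalence C (n + 1) η
    (N.θ - N'.θ + hatMap (dualityMap φ) (dualSusp C n χ)) 0

end Complexes
end AlgPoincare

end

noncomputable section

namespace AlgPoincare

section

variable {A : Type u} [Ring A] [StarRing A]

/-! ### Additivity of `f ⊗ g` in each of the two maps. -/

namespace TensorT

variable {M N M' N' : Type u}
  [AddCommGroup M] [Module A M] [AddCommGroup N] [Module A N]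
  [AddCommGroup M'] [Module A M'] [AddCommGroup N'] [Module A N']

/-! Everything follows from the bijectivity of the composite `Q̂^0(C^{0-*}) → Q̂^n(C^{n-*}) →
Q̂^n(C)` and of its analogue one degree higher. The first arrow `S^n` is bijective already on chains
(`dualSusp_bijective`): a hyperquadratic chain is indexed by all `s ∈ ℤ`, so regrading loses
nothing. The second is induced by `φ_0`. Since `f ↦ f̂^%` sends homotopic chain maps to homotopic
ones (`hatHomotopy_hatD`), a chain equivalence induces isomorphisms in every degree
(`qMap_bijective`), and Poincaré duality says that `φ_0` is one.

A normal structure is a cycle `γ` together with a chain exhibiting its image as homologous to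
`J(φ)`. Hence `[γ]` is forced to be the preimage of `J[φ]`, and surjectivity in degree `n` gives
existence.

For uniqueness, injectivity in degree `n` gives `χ : γ → γ'`. The remaining obstruction is the class
of `θ - θ' + (φ̂_0)^%(S^n χ)` in `Q̂^{n+1}(C)`. As `χ` may be altered by any cycle of degree `1`,
surjectivity in degree `n + 1` removes it. -/

theorem map_id_id (z : TensorT A M N) : map LinearMap.id LinearMap.id z = z :=
  DFunLike.congr_fun (hom_ext (f := map (LinearMap.id : M →ₗ[A] M) (LinearMap.id : N →ₗ[A] N))
    (g := AddMonoidHom.id _) (fun _ _ => rfl)) z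

theorem map_add_left (f f' : M →ₗ[A] M') (g : N →ₗ[A] N') (z : TensorT A M N) :
    map (f + f') g z = map f g z + map f' g z :=
  DFunLike.congr_fun (hom_ext (f := map (f + f') g) (g := map f g + map f' g)
    (fun _ _ => add_tmul _ _ _)) z

theorem map_add_right (f : M →ₗ[A] M') (g g' : N →ₗ[A] N') (z : TensorT A M N) :
    map f (g + g') z = map f g z + map f g' z :=
  DFunLike.congr_fun (hom_ext (f := map f (g + g')) (g := map f g + map f g')
    (fun _ _ => tmul_add _ _ _)) z

theorem map_sub_left (f f' : M →ₗ[A] M') (g : N →ₗ[A] N') (z : TensorT A M N) :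
    map (f - f') g z = map f g z - map f' g z := by
  rw [eq_sub_iff_add_eq, ← map_add_left, sub_add_cancel]

theorem map_sub_right (f : M →ₗ[A] M') (g g' : N →ₗ[A] N') (z : TensorT A M N) :
    map f (g - g') z = map f g z - map f g' z := by
  rw [eq_sub_iff_add_eq, ← map_add_right, sub_add_cancel]

end TensorT

/-! ### Operators on hyperquadratic chains -/

/-- The operator on hyperquadratic chains whose `(p, q)` component is `F p q` applied to the
component in bidegree `(p + a, q + b)`. -/
def HatChain.shiftMap {C D : ChainComplex (ModuleCat.{u} A) ℤ} (a b : ℤ)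
    (F : ∀ p q : ℤ, TensorT A (C.X (p + a)) (C.X (q + b)) →+ TensorT A (D.X p) (D.X q)) :
    HatChain C →+ HatChain D :=
  -- The shift of bidegrees is injective, so pulling back along it preserves finite support in each
  -- total degree.
  let e : ∀ k, {i : ℤ × ℤ // i.1 + i.2 = k} → {i : ℤ × ℤ // i.1 + i.2 = k + a + b} :=
    fun k i => ⟨(i.1.1 + a, i.1.2 + b), by have := i.2; simp only; omega⟩
  have he : ∀ k, Function.Injective (e k) := fun k i j hij => by
    have h1 : i.1.1 + a = j.1.1 + a := congrArg (fun x => x.1.1) hij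
    have h2 : i.1.2 + b = j.1.2 + b := congrArg (fun x => x.1.2) hij
    exact Subtype.ext (Prod.ext (by omega) (by omega))
  { toFun := fun θ k => DirectSum.map
      (α := fun i : {i : ℤ × ℤ // i.1 + i.2 = k} =>
        TensorT A (C.X (i.1.1 + a)) (C.X (i.1.2 + b)))
      (fun i => F i.1.1 i.1.2) (DFinsupp.comapDomain (e k) (he k) (θ (k + a + b)))
    map_zero' := by
      ext k : 1
      exact (congrArg _ (DFinsupp.comapDomain_zero (e k) (he k))).trans (map_zero _)
    map_add' := fun θ θ' => by
      ext k : 1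
      exact (congrArg _ (DFinsupp.comapDomain_add (e k) (he k) _ _)).trans (map_add _ _ _) }

theorem HatChain.shiftMap_comp {C D : ChainComplex (ModuleCat.{u} A) ℤ} (a b : ℤ)
    (F : ∀ p q : ℤ, TensorT A (C.X (p + a)) (C.X (q + b)) →+ TensorT A (D.X p) (D.X q))
    (θ : HatChain C) (p q : ℤ) :
    (HatChain.shiftMap a b F θ).comp p q = F p q (θ.comp (p + a) (q + b)) := by
  rw [← HatChain.apply_eq θ (p + q + a + b) (p + a) (q + b) (by omega)]
  exact DirectSum.map_apply _ _ _

@[simp] theorem HatChain.add_comp {C : ChainComplex (ModuleCat.{u} A) ℤ} (θ θ' : HatChain C)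
    (p q : ℤ) : (θ + θ').comp p q = θ.comp p q + θ'.comp p q := rfl

@[simp] theorem HatChain.sub_comp {C : ChainComplex (ModuleCat.{u} A) ℤ} (θ θ' : HatChain C)
    (p q : ℤ) : (θ - θ').comp p q = θ.comp p q - θ'.comp p q := rfl

/-- The transposition `T` on all the components of a hyperquadratic chain. -/
def hatT (C : ChainComplex (ModuleCat.{u} A) ℤ) : HatChain C →+ HatChain C where
  toFun θ k := tensT C k (θ k)
  map_zero' := by ext k : 1; simp
  map_add' θ θ' := by ext k : 1; simp

theorem hatT_comp (C : ChainComplex (ModuleCat.{u} A) ℤ) (θ : HatChain C) (p q : ℤ) :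
    (hatT C θ).comp p q = (p * q).negOnePow • TensorT.swap (θ.comp q p) := by
  rw [← HatChain.apply_eq θ (p + q) q p (by omega)]
  exact tensT_apply C (p + q) p q rfl _

/-! ### Homotopy invariance -/

/-- The chain homotopy `Ŵ^% C → Ŵ^% D` in degree `m` induced by a chain homotopy `h : f ≃ g`:
`f ⊗ h ± h ⊗ g ± (h ⊗ h) T`. -/
def hatHomotopy {C D : ChainComplex (ModuleCat.{u} A) ℤ} {f g : C ⟶ D} (h : Homotopy f g)
    (m : ℤ) : HatChain C →+ HatChain D :=
  HatChain.shiftMap 0 (-1) (fun p q =>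
      TensorT.map ((C.XIsoOfEq (add_zero p)).hom ≫ f.f p).hom (h.hom (q + -1) q).hom) +
  HatChain.shiftMap (-1) 0 (fun p q => q.negOnePow •
      TensorT.map (h.hom (p + -1) p).hom ((C.XIsoOfEq (add_zero q)).hom ≫ g.f q).hom) +
  (HatChain.shiftMap (-1) (-1) (fun p q => (m + q).negOnePow •
      TensorT.map (h.hom (p + -1) p).hom (h.hom (q + -1) q).hom)).comp (hatT C)

/-- A shift by `0` lands in `C.X (p + 0)`, which is not definitionally `C.X p`. This lemma and its
right-hand twin absorb the resulting transport into the index of `θ`. -/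
theorem HatChain.map_XIsoOfEq_left {C : ChainComplex (ModuleCat.{u} A) ℤ} {M N : Type u}
    [AddCommGroup M] [Module A M] [AddCommGroup N] [Module A N] (θ : HatChain C) {p p' q : ℤ}
    (hp : p = p') (f : C.X p' →ₗ[A] M) (g : C.X q →ₗ[A] N) :
    TensorT.map (f.comp (C.XIsoOfEq hp).hom.hom) g (θ.comp p q) =
      TensorT.map f g (θ.comp p' q) := by
  subst hp; simp [HomologicalComplex.XIsoOfEq]

theorem HatChain.map_XIsoOfEq_right {C : ChainComplex (ModuleCat.{u} A) ℤ} {M N : Type u}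
    [AddCommGroup M] [Module A M] [AddCommGroup N] [Module A N] (θ : HatChain C) {p q q' : ℤ}
    (hq : q = q') (f : C.X p →ₗ[A] M) (g : C.X q' →ₗ[A] N) :
    TensorT.map f (g.comp (C.XIsoOfEq hq).hom.hom) (θ.comp p q) =
      TensorT.map f g (θ.comp p q') := by
  subst hq; simp [HomologicalComplex.XIsoOfEq]

/-- The predecessors `p'`, `q'` are free variables so that at `p + 1` the predecessor can be taken
to be `p` itself, with no transport between equal degrees. -/
theorem hatHomotopy_comp {C D : ChainComplex (ModuleCat.{u} A) ℤ} {f g : C ⟶ D}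
    (h : Homotopy f g) (m p q p' q' : ℤ) (hp : p' + 1 = p) (hq : q' + 1 = q) (θ : HatChain C) :
    (hatHomotopy h m θ).comp p q =
      TensorT.map (f.f p).hom (h.hom q' q).hom (θ.comp p q') +
      q.negOnePow • TensorT.map (h.hom p' p).hom (g.f q).hom (θ.comp p' q) +
      (m + q).negOnePow • (p' * q').negOnePow •
        TensorT.map (h.hom p' p).hom (h.hom q' q).hom (TensorT.swap (θ.comp q' p')) := by
  obtain rfl : p' = p + -1 := by omega
  obtain rfl : q' = q + -1 := by omega
  simp only [hatHomotopy, AddMonoidHom.add_apply, AddMonoidHom.comp_apply, HatChain.add_comp,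
    HatChain.shiftMap_comp, ModuleCat.hom_comp, hatT_comp]
  congr 1
  · congr 1
    · exact HatChain.map_XIsoOfEq_left θ (add_zero p) _ _
    · rw [AddMonoidHom.smul_apply]
      congr 1
      exact HatChain.map_XIsoOfEq_right θ (add_zero q) _ _
  · rw [AddMonoidHom.smul_apply, map_units_smul']

/-- The homotopy relation solved for `d h`: used as a rewrite rule it leaves `h d` as the only
composite of `h` and `d`. -/
theorem homotopy_d_comp_hom {C D : ChainComplex (ModuleCat.{u} A) ℤ} {f g : C ⟶ D}
    (h : Homotopy f g) (i j k : ℤ) (hi : j + 1 = i) (hk : i + 1 = k) :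
    (D.d k i).hom.comp (h.hom i k).hom =
      (f.f i).hom - (g.f i).hom - (h.hom j i).hom.comp (C.d i j).hom := by
  have hc := h.comm i
  rw [dNext_eq h.hom (show (ComplexShape.down ℤ).Rel i j from hi),
    prevD_eq h.hom (show (ComplexShape.down ℤ).Rel k i from hk)] at hc
  rw [hc]
  simp only [ModuleCat.hom_add, ModuleCat.hom_comp]
  abel

/-- The map `f ⊗ h ± h ⊗ g` is a homotopy from `f ⊗ f` to `g ⊗ g`, but conjugation by `T` exchanges
the roles of `f` and `g` in it. The defect consists of `(f - g) ⊗ h` and `h ⊗ (f - g)`, which with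
`f - g = d h + h d` is the boundary of `h ⊗ h` up to sign. The `(h ⊗ h) T` term, fed by `θ_{s-1}`,
cancels it against the `1 ± T` part of the differential. -/
theorem hatHomotopy_hatD {C D : ChainComplex (ModuleCat.{u} A) ℤ} {f g : C ⟶ D}
    (h : Homotopy f g) (m : ℤ) (θ : HatChain C) :
    hatD D (m + 1) (hatHomotopy h m θ) + hatHomotopy h (m - 1) (hatD C m θ) =
      hatMap f θ - hatMap g θ := by
  have hf : ∀ i j, (f.f j).hom.comp (C.d i j).hom = (D.d i j).hom.comp (f.f i).hom := by
    intro i j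
    rw [← ModuleCat.hom_comp, ← ModuleCat.hom_comp, f.comm]
  have hg : ∀ i j, (g.f j).hom.comp (C.d i j).hom = (D.d i j).hom.comp (g.f i).hom := by
    intro i j
    rw [← ModuleCat.hom_comp, ← ModuleCat.hom_comp, g.comm]
  refine HatChain.ext_comp fun p q => ?_
  obtain ⟨p', hp⟩ : ∃ p', p' + 1 = p := ⟨p - 1, by ring⟩
  obtain ⟨q', hq⟩ : ∃ q', q' + 1 = q := ⟨q - 1, by ring⟩
  have dh := fun i j k => homotopy_d_comp_hom h i j k
  rw [HatChain.add_comp, HatChain.sub_comp, hatMap_comp, hatMap_comp,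
    hatD_comp D (m + 1) p q _ _ rfl rfl,
    hatHomotopy_comp h m p (q + 1) p' q hp rfl,
    hatHomotopy_comp h m (p + 1) q p q' rfl hq,
    hatHomotopy_comp h m p q p' q' hp hq,
    hatHomotopy_comp h m q p q' p' hq hp,
    hatHomotopy_comp h (m - 1) p q p' q' hp hq,
    hatD_comp C m p q' _ _ rfl hq, hatD_comp C m p' q _ _ hp rfl,
    hatD_comp C m q' p' _ _ hq hp]
  -- Normal form: differentials are moved past `f` and `g` to the target, each `d h` is eliminated,
  -- and swaps are moved innermost. Only signs remain to be compared.
  simp only [map_add, map_units_smul', smul_add, smul_smul, ← Int.negOnePow_add,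
    TensorT.map_comp_map, TensorT.swap_swap, LinearMap.comp_id, LinearMap.id_comp,
    ← TensorT.map_swap, hf, hg, dh p p' (p + 1) hp rfl, dh q q' (q + 1) hq rfl,
    TensorT.map_sub_left, TensorT.map_sub_right, smul_sub]
  have hs : ∀ a : ℤ, a.negOnePow = if Even a then 1 else -1 := fun a => by
    split_ifs with h
    · exact Int.negOnePow_even a h
    · exact Int.negOnePow_odd a (Int.not_even_iff_odd.1 h)
  obtain rfl : p' = p - 1 := by omega
  obtain rfl : q' = q - 1 := by omega
  -- Every sign depends only on the parities of `p`, `q` and `m`; each of the eight cases is a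
  -- formal identity in an abelian group.
  by_cases h1 : Even p <;> by_cases h2 : Even q <;> by_cases h3 : Even m <;>
    simp only [hs, Int.even_add, Int.even_sub, Int.even_mul, Int.not_even_one, h1, h2, h3,
      iff_true, iff_false, not_true_eq_false, or_self, iff_self,
      or_true, or_false, if_true, if_false, one_smul, Units.neg_smul] <;> abel

/-! ### Functoriality and chain equivalences -/

theorem hatMap_id (C : ChainComplex (ModuleCat.{u} A) ℤ) (θ : HatChain C) :
    hatMap (𝟙 C) θ = θ := by
  refine HatChain.ext_comp fun p q => ?_
  rw [hatMap_comp]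
  exact TensorT.map_id_id _

theorem hatMap_hatMap {C D E : ChainComplex (ModuleCat.{u} A) ℤ} (f : C ⟶ D) (g : D ⟶ E)
    (θ : HatChain C) : hatMap g (hatMap f θ) = hatMap (f ≫ g) θ := by
  refine HatChain.ext_comp fun p q => ?_
  rw [hatMap_comp, hatMap_comp, hatMap_comp, TensorT.map_comp_map]
  rfl

/-- The difference is oriented as in `IsHatEquivalence`, so a witness `z` is precisely an
equivalence from `x` to `y`. -/
theorem HatQ.mk_eq_mk_iff {C : ChainComplex (ModuleCat.{u} A) ℤ} {m : ℤ} (x y : hatCycles C m) :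
    HatQ.mk C m x = HatQ.mk C m y ↔ ∃ z, hatD C (m + 1) z = y.1 - x.1 := by
  refine QuotientAddGroup.eq.trans ?_
  rw [AddSubgroup.mem_addSubgroupOf, neg_add_eq_sub]
  rfl

theorem HatQ.mk_surjective (C : ChainComplex (ModuleCat.{u} A) ℤ) (m : ℤ) :
    Function.Surjective (HatQ.mk C m) :=
  QuotientAddGroup.mk'_surjective _

/-- Homotopic chain maps induce the same map on hyperquadratic `Q`-groups. -/
theorem qMap_eq_of_homotopy {C D : ChainComplex (ModuleCat.{u} A) ℤ} {f g : C ⟶ D}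
    (h : Homotopy f g) (m : ℤ) : qMap f m = qMap g m := by
  refine DFunLike.ext _ _ fun x => ?_
  obtain ⟨x, rfl⟩ := HatQ.mk_surjective C m x
  have hx : hatD C m x.1 = 0 := x.2
  have hx' : ∀ k : C ⟶ D, hatD D m (hatMap k x.1) = 0 := fun k => by
    rw [← hatMap_hatD, hx, map_zero]
  -- On a cycle the second term of the homotopy identity vanishes, so the difference of the two
  -- images is a boundary.
  have hd := hatHomotopy_hatD h m x.1
  rw [hx, map_zero, add_zero] at hd
  exact ((HatQ.mk_eq_mk_iff (C := D) (m := m) ⟨_, hx' g⟩ ⟨_, hx' f⟩).2 ⟨_, hd⟩).symm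

theorem qMap_id (C : ChainComplex (ModuleCat.{u} A) ℤ) (m : ℤ) (x : HatQ C m) :
    qMap (𝟙 C) m x = x := by
  obtain ⟨x, rfl⟩ := HatQ.mk_surjective C m x
  exact congrArg (HatQ.mk C m) (Subtype.ext (hatMap_id C x.1))

theorem qMap_qMap {C D E : ChainComplex (ModuleCat.{u} A) ℤ} (f : C ⟶ D) (g : D ⟶ E) (m : ℤ)
    (x : HatQ C m) : qMap g m (qMap f m x) = qMap (f ≫ g) m x := by
  obtain ⟨x, rfl⟩ := HatQ.mk_surjective C m x
  exact congrArg (QuotientAddGroup.mk' _) (Subtype.ext (hatMap_hatMap f g x.1))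

/-- A chain equivalence induces isomorphisms of hyperquadratic `Q`-groups. -/
theorem qMap_bijective {C D : ChainComplex (ModuleCat.{u} A) ℤ} (e : HomotopyEquiv C D) (m : ℤ) :
    Function.Bijective (qMap e.hom m) := by
  refine Function.bijective_iff_has_inverse.2 ⟨qMap e.inv m, fun x => ?_, fun x => ?_⟩
  · rw [qMap_qMap, qMap_eq_of_homotopy e.homotopyHomInvId, qMap_id]
  · rw [qMap_qMap, qMap_eq_of_homotopy e.homotopyInvHomId, qMap_id]

/-! ### The suspension isomorphism -/

/-- The canonical map `(S^n C)_{p+n} → C_p`. -/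
def desuspX (C : ChainComplex (ModuleCat.{u} A) ℤ) (n p : ℤ) :
    (suspension C n).X (p + n) →ₗ[A] C.X p :=
  (C.XIsoOfEq (show p + n - n = p by ring)).hom.hom

/-- The inverse of `S^n : Ŵ^% C → Ŵ^% (S^n C)`. -/
def hatDesusp (C : ChainComplex (ModuleCat.{u} A) ℤ) (n : ℤ) :
    HatChain (suspension C n) →+ HatChain C :=
  -- This is the sign that `S^n` puts on bidegree `(p + n, q + n)`; it is its own inverse.
  HatChain.shiftMap n n fun p q => (n * (p + n)).negOnePow •
    TensorT.map (desuspX C n p) (desuspX C n q)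

theorem hatDesusp_comp (C : ChainComplex (ModuleCat.{u} A) ℤ) (n : ℤ)
    (θ : HatChain (suspension C n)) (p q : ℤ) :
    (hatDesusp C n θ).comp p q = (n * (p + n)).negOnePow •
      TensorT.map (desuspX C n p) (desuspX C n q) (θ.comp (p + n) (q + n)) :=
  HatChain.shiftMap_comp n n _ θ p q

theorem negOnePow_smul_self {G : Type*} [AddCommGroup G] (a : ℤ) (x : G) :
    a.negOnePow • a.negOnePow • x = x := by
  rw [smul_smul, ← Int.negOnePow_add, Int.negOnePow_even _ ⟨a, rfl⟩, one_smul]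

theorem HatChain.map_XIsoOfEq {C : ChainComplex (ModuleCat.{u} A) ℤ} (θ : HatChain C)
    {p q p' q' : ℤ} (hp : p = p') (hq : q = q') :
    TensorT.map (C.XIsoOfEq hp).hom.hom (C.XIsoOfEq hq).hom.hom (θ.comp p q) =
      θ.comp p' q' := by
  subst hp hq
  exact TensorT.map_id_id _

theorem hatDesusp_hatSusp (C : ChainComplex (ModuleCat.{u} A) ℤ) (n : ℤ) (θ : HatChain C) :
    hatDesusp C n (hatSusp C n θ) = θ := by
  refine HatChain.ext_comp fun p q => ?_
  rw [hatDesusp_comp, hatSusp_comp, map_units_smul', negOnePow_smul_self]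
  exact HatChain.map_XIsoOfEq θ (add_sub_cancel_right p n) (add_sub_cancel_right q n)

theorem hatSusp_hatDesusp (C : ChainComplex (ModuleCat.{u} A) ℤ) (n : ℤ)
    (θ : HatChain (suspension C n)) : hatSusp C n (hatDesusp C n θ) = θ := by
  refine HatChain.ext_comp fun p q => ?_
  -- Only the sign is rewritten here: the same expression also indexes dependent types, where the
  -- change of index is handled by `HatChain.map_XIsoOfEq`.
  have hs : (n * (p - n + n)).negOnePow = (n * p).negOnePow := by rw [sub_add_cancel]
  rw [hatSusp_comp, HatChain.suspComp, hatDesusp_comp, hs]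
  refine (negOnePow_smul_self _ _).trans ?_
  exact HatChain.map_XIsoOfEq θ (sub_add_cancel p n) (sub_add_cancel q n)

/-- Here it matters that `s` runs over all of `ℤ`: on families with `s ≥ 0` the shift by `n > 0`
would in general not be onto. -/
theorem hatSusp_bijective (C : ChainComplex (ModuleCat.{u} A) ℤ) (n : ℤ) :
    Function.Bijective (hatSusp C n) :=
  Function.bijective_iff_has_inverse.2
    ⟨hatDesusp C n, hatDesusp_hatSusp C n, hatSusp_hatDesusp C n⟩

theorem hatMap_bijective {C D : ChainComplex (ModuleCat.{u} A) ℤ} (f : C ⟶ D) [IsIso f] :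
    Function.Bijective (hatMap f) := by
  refine Function.bijective_iff_has_inverse.2 ⟨hatMap (inv f), fun x => ?_, fun x => ?_⟩
  · rw [hatMap_hatMap, IsIso.hom_inv_id, hatMap_id]
  · rw [hatMap_hatMap, IsIso.inv_hom_id, hatMap_id]

theorem InvDual.map_bijective {M N : Type u} [AddCommGroup M] [Module A M] [AddCommGroup N]
    [Module A N] (e : ModuleCat.of A M ≅ ModuleCat.of A N) :
    Function.Bijective (InvDual.map e.hom.hom) := by
  refine Function.bijective_iff_has_inverse.2 ⟨InvDual.map e.inv.hom, fun g => ?_, fun g => ?_⟩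
  · ext x
    exact congrArg g (ConcreteCategory.congr_hom e.inv_hom_id x)
  · ext x
    exact congrArg g (ConcreteCategory.congr_hom e.hom_inv_id x)

/-- In each degree the map is, up to sign, the dual of the identification `C_{n-r} = C_{0-(r-n)}`.
-/
instance suspensionDual_isIso (C : ChainComplex (ModuleCat.{u} A) ℤ) (n : ℤ) :
    IsIso (suspensionDual C n) := by
  have : ∀ r, IsIso ((suspensionDual C n).f r) := fun r => by
    rw [ConcreteCategory.isIso_iff_bijective]
    have hb := InvDual.map_bijective (C.XIsoOfEq (show n - r = 0 - (r - n) by ring))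
    change Function.Bijective ((n * r).negOnePow •
      InvDual.map (C.XIsoOfEq (show n - r = 0 - (r - n) by ring)).hom.hom)
    rcases Int.units_eq_one_or (n * r).negOnePow with h | h
    · rw [h, one_smul]
      exact hb
    · rw [h, Units.neg_smul, one_smul]
      exact (Equiv.neg _).bijective.comp hb
  exact HomologicalComplex.Hom.isIso_of_components _

theorem dualSusp_bijective (C : ChainComplex (ModuleCat.{u} A) ℤ) (n : ℤ) :
    Function.Bijective (dualSusp C n) :=
  (hatMap_bijective (suspensionDual C n)).comp (hatSusp_bijective (nDual C 0) n)

/-- The boundary of the unique preimage maps to the boundary of `y`, which is zero, so injectivity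
makes the preimage a cycle. The degree is left free because bundles need `m = 0` and equivalences of
bundles need `m = 1`. -/
theorem exists_cycle_dualSusp (C : ChainComplex (ModuleCat.{u} A) ℤ) (n m m' : ℤ)
    (hm : m' = m + n) (y : hatCycles (nDual C n) m') :
    ∃ x : hatCycles (nDual C 0) m, dualSusp C n x.1 = y.1 := by
  obtain ⟨x, hx⟩ := (dualSusp_bijective C n).2 y.1
  refine ⟨⟨x, (dualSusp_bijective C n).1 ?_⟩, hx⟩
  rw [map_zero, dualSusp_hatD C n m m' hm, hx]
  exact y.2

theorem qSusp_bijective (C : ChainComplex (ModuleCat.{u} A) ℤ) (n : ℤ) :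
    Function.Bijective (qSusp C n) := by
  constructor
  · intro x y hxy
    obtain ⟨x, rfl⟩ := HatQ.mk_surjective _ _ x
    obtain ⟨y, rfl⟩ := HatQ.mk_surjective _ _ y
    obtain ⟨z, hz⟩ := (HatQ.mk_eq_mk_iff _ _).1 hxy
    -- The bounding chain itself desuspends, so injectivity on homology needs surjectivity on chains
    -- one degree up.
    obtain ⟨w, rfl⟩ := (dualSusp_bijective C n).2 z
    refine (HatQ.mk_eq_mk_iff _ _).2 ⟨w, (dualSusp_bijective C n).1 ?_⟩
    rw [dualSusp_hatD C n (0 + 1) (n + 1) (by ring), hz, map_sub]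
    rfl
  · intro y
    obtain ⟨y, rfl⟩ := HatQ.mk_surjective _ _ y
    obtain ⟨x, hx⟩ := exists_cycle_dualSusp C n 0 n (by ring) y
    exact ⟨HatQ.mk _ _ x, congrArg (HatQ.mk (nDual C n) n) (Subtype.ext hx)⟩

/-! ### Normal structures -/

variable {C : ChainComplex (ModuleCat.{u} A) ℤ} {n : ℤ} {φ : symCycles C n}

/-- The bundle of a normal structure on `(C, φ)` corresponds to the class of `J(φ)`. -/
theorem NormalStructure.qMap_qSusp_mk (N : NormalStructure φ) :
    qMap (dualityMap φ) n (qSusp C n (HatQ.mk (nDual C 0) 0 N.γ)) = qJ C n (SymQ.mk C n φ) :=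
  ((HatQ.mk_eq_mk_iff (C := C) (m := n) ⟨φ.1, φ.2.2⟩ ⟨_, _⟩).2 ⟨N.θ, N.equiv.symm⟩).symm

/-- A preimage of `J[φ]` is represented by some `γ`, and the equality of classes, unfolded to
chains, is `θ`. -/
theorem nonempty_normalStructure
    (h : Function.Surjective ((qMap (dualityMap φ) n).comp (qSusp C n))) :
    Nonempty (NormalStructure φ) := by
  obtain ⟨x, hx⟩ := h (qJ C n (SymQ.mk C n φ))
  obtain ⟨γ, rfl⟩ := HatQ.mk_surjective _ _ x
  obtain ⟨θ, hθ⟩ :=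
    (HatQ.mk_eq_mk_iff (C := C) (m := n) ⟨φ.1, φ.2.2⟩ ⟨_, _⟩).1 hx.symm
  exact ⟨⟨γ, θ, hθ.symm⟩⟩

/-- Injectivity in degree `n` produces some `χ`; surjectivity in degree `n + 1` then corrects it so
that `η` exists. -/
theorem NormalStructure.nonempty_equivalence
    (h : Function.Injective ((qMap (dualityMap φ) n).comp (qSusp C n)))
    (h' : Function.Surjective (qMap (dualityMap φ) (n + 1))) (N N' : NormalStructure φ) :
    Nonempty (N.Equivalence N') := by
  have hγ : HatQ.mk (nDual C 0) 0 N.γ = HatQ.mk (nDual C 0) 0 N'.γ :=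
    h (N.qMap_qSusp_mk.trans N'.qMap_qSusp_mk.symm)
  obtain ⟨χ, hχ⟩ := (HatQ.mk_eq_mk_iff _ _).1 hγ
  -- The boundaries of `θ` and `θ'` both involve `J(φ)`, which cancels; what is left is the
  -- difference of the images of `γ` and `γ'`, cancelled by the boundary of the image of `χ`.
  have hc : hatD C (n + 1) (N.θ - N'.θ + hatMap (dualityMap φ) (dualSusp C n χ)) = 0 := by
    have e := N.equiv
    have e' := N'.equiv
    rw [IsHatEquivalence] at e e'
    rw [map_add, map_sub, ← e, ← e', ← hatMap_hatD,
      ← dualSusp_hatD C n (0 + 1) (n + 1) (by ring), hχ, map_sub, map_sub]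
    abel
  -- The obstruction class is realised by a cycle on `C^{n-*}`, which desuspends to a cycle `ξ` of
  -- degree `1` on `C^{0-*}`.
  obtain ⟨x, hx⟩ := h' (HatQ.mk C (n + 1) ⟨_, hc⟩)
  obtain ⟨x, rfl⟩ := HatQ.mk_surjective _ _ x
  obtain ⟨ξ, hξ⟩ := exists_cycle_dualSusp C n (0 + 1) (n + 1) (by ring) x
  obtain ⟨η, hη⟩ := (HatQ.mk_eq_mk_iff (C := C) (m := n + 1) ⟨_, hc⟩ ⟨_, _⟩).1 hx.symm
  -- Subtracting the cycle `ξ` leaves the boundary of `χ` unchanged and makes the obstruction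
  -- null-homologous.
  refine ⟨⟨χ - ξ.1, ?_, η, ?_⟩⟩
  · have hξ0 : hatD (nDual C 0) (0 + 1) ξ.1 = 0 := ξ.2
    rw [IsHatEquivalence, map_sub, hχ, hξ0, sub_zero]
  · rw [IsHatEquivalence, hη, map_sub, map_sub, hξ]
    change _ = hatMap (dualityMap φ) x.1 -
      (N.θ - N'.θ + hatMap (dualityMap φ) (dualSusp C n χ))
    abel

end

end AlgPoincare

end

/-! ### Normal structures on symmetric Poincaré complexes. -/

theorem mainTheorem4 {A : Type u} [Ring A] [StarRing A] (n : ℕ)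
    (C : ChainComplex (ModuleCat.{u} A) ℤ) (hC : AlgPoincare.IsDimensional C n)
    (φ : AlgPoincare.symCycles C n) (hφ : AlgPoincare.IsPoincare φ) :
    Nonempty (AlgPoincare.NormalStructure φ) ∧
    (∀ N N' : AlgPoincare.NormalStructure φ, Nonempty (N.Equivalence N')) ∧
    ∃ (hφ0 : Function.Bijective (AlgPoincare.qMap (AlgPoincare.dualityMap φ) n))
      (hS : Function.Bijective (AlgPoincare.qSusp C n)),
      ∀ N : AlgPoincare.NormalStructure φ,
        AlgPoincare.HatQ.mk (AlgPoincare.nDual C 0) 0 N.γ =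
          (AddEquiv.ofBijective (AlgPoincare.qSusp C n) hS).symm
            ((AddEquiv.ofBijective (AlgPoincare.qMap (AlgPoincare.dualityMap φ) n) hφ0).symm
              (AlgPoincare.qJ C n (AlgPoincare.SymQ.mk C n φ))) := by
  obtain ⟨e, he⟩ := hφ
  -- All `m` at once: degree `n` serves existence and `χ`, degree `n + 1` serves `η`.
  have hφ0 : ∀ m, Function.Bijective (AlgPoincare.qMap (AlgPoincare.dualityMap φ) m) := fun m =>
    he ▸ AlgPoincare.qMap_bijective e m
  have hS := AlgPoincare.qSusp_bijective C n
  have hb := (hφ0 n).comp hS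
  refine ⟨AlgPoincare.nonempty_normalStructure hb.2,
    AlgPoincare.NormalStructure.nonempty_equivalence hb.1 (hφ0 (n + 1)).2, hφ0 n, hS,
    fun N => ?_⟩
  rw [AddEquiv.eq_symm_apply, AddEquiv.eq_symm_apply]
  exact N.qMap_qSusp_mk
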